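/- A \emph{legally directed diagram} is a finite trivalent graph based on an oriented circle (the univalent ends of the graph, called external vertices, lie at distinct points of the circle; the remaining, internal, vertices are trivalent and carry a cyclic orientation; the graph together with the circle is connected), in which every edge outside the circle carries an arrow such that every internal vertex has exactly one incoming and two outgoing edges. Multiple edges and edges from a vertex to itself are allowed, and diagrams are taken up to isomorphism preserving all this structure. The \emph{degree} of a diagram is the number of its edges outside the circle minus the number of its internal vertices. Let $\overrightarrow{\mathcal A(S^1)}$ be the complex vector space spanned by all legally directed diagrams modulo (AS) reversing the orientation of one internal vertex changes the sign; (IHX) $I=H-X$ for each edge joining two distinct internal vertices, with all legal directions (for given directions of the four outer edges, the direction of the middle edge in each of $I$, $H$, $X$ is determined); (STU) $S-T=U$, where $S$ has two edges ending at neighbouring points of the circle, $T$ is obtained from $S$ by exchanging these two points, and $U$ is obtained by joining the two edges to a new internal vertex connected to the circle by one edge, the arrows of the two edges being kept and that of the new edge being determined by legality; if both arrows of $S$ point towards the circle, there is no legal $U$ and the relation is $S-T=0$. A diagram is \emph{primitive} if it is nonempty and remains connected when the circle is removed; primitive elements (of degree $n$) are the linear combinations of classes of primitive diagrams (of degree $n$).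 Let $\theta$ be the diagram consisting of a single directed chord. \textbf{Proposition.} (1) The class in $\overrightarrow{\mathcal A(S^1)}$ of every primitive diagram other than $\theta$ is zero. Hence there is no nonzero primitive element of degree $n\neq 1$, and the primitive elements of degree $1$ are exactly the multiples of $\theta$. (2) The connected sum of diagrams along the circle induces a well-defined bilinear product on $\overrightarrow{\mathcal A(S^1)}$ (independent of the places where the circles are cut). For this product, with the bare circle as $\theta^0$, the class of every diagram of degree $n\ge 0$ is either $0$ or $\theta^n$; hence every element of degree $n$ is a scalar multiple of $\theta^n$. -/

import Mathlib

/-- Half-edges of a legally directed diagram with external vertices ("legs") `L` and internal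
vertices `V`.  An external vertex carries one half-edge.  A legal internal vertex carries one
ingoing half-edge `inn v` and two outgoing half-edges `out v false`, `out v true`; its cyclic
orientation is `inn v → out v false → out v true → inn v`. -/
inductive HalfEdge (L V : Type) : Type
  | leg (x : L) : HalfEdge L V
  | inn (v : V) : HalfEdge L V
  | out (v : V) (c : Bool) : HalfEdge L V

namespace HalfEdge

/-- Relabelling of half-edges. -/
def map {L V L' V' : Type} (f : L → L') (g : V → V') : HalfEdge L V → HalfEdge L' V'
  | leg x => leg (f x)
  | inn v => inn (g v)
  | out v c => out (g v) c

/-- The three half-edges at an internal vertex, in the cyclic order of its orientation. -/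
def corner {L V : Type} (v : V) : Fin 3 → HalfEdge L V
  | 0 => inn v
  | 1 => out v false
  | 2 => out v true

/-- The vertex (external or internal) at which a half-edge sits. -/
def vertex {L V : Type} : HalfEdge L V → L ⊕ V
  | leg x => Sum.inl x
  | inn v => Sum.inr v
  | out v _ => Sum.inr v

/-- Does a half-edge carry the head of the arrow of its edge?  For the half-edges at external
vertices this is told by `inward`. -/
def isHead {L V : Type} (inward : L → Bool) : HalfEdge L V → Bool
  | leg x => inward x
  | inn _ => true
  | out _ _ => false

end HalfEdge

/-- A legally directed diagram: a finite trivalent graph based on an oriented circle, with oriented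
internal vertices and an arrow on every edge outside the circle, such that every internal vertex has
one ingoing and two outgoing edges.  Multiple edges and edges from a vertex to itself are allowed.
(Every such graph is automatically connected to the circle, see
`DirectedDiagram.exists_reachable_leg`.) -/
structure DirectedDiagram : Type 1 where
  /-- external vertices -/
  Leg : Type
  /-- internal vertices -/
  Ver : Type
  finite_ver : Finite Ver
  /-- the cyclic order of the external vertices along the oriented circle -/
  circle : Cycle Leg
  nodup : circle.Nodup
  mem_circle : ∀ x, x ∈ circle
  /-- does the arrow of the edge ending at this external vertex point towards the circle? -/
  inward : Leg → Bool
  /-- the other half of an edge -/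
  opp : HalfEdge Leg Ver → HalfEdge Leg Ver
  opp_opp : ∀ h, opp (opp h) = h
  /-- every edge has one half carrying its head and one half carrying its tail -/
  opp_head : ∀ h, (opp h).isHead inward = !h.isHead inward

namespace DirectedDiagram

open HalfEdge

/-- Does a half-edge of `D` carry the head of the arrow of its edge? -/
def isHead (D : DirectedDiagram) (h : HalfEdge D.Leg D.Ver) : Bool := HalfEdge.isHead D.inward h

theorem isHead_opp (D : DirectedDiagram) (h : HalfEdge D.Leg D.Ver) :
    D.isHead (D.opp h) = !D.isHead h := D.opp_head h

/-- The graph that is left when the base circle is removed: its vertices are the external and the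
internal vertices, its edges are the directed edges of the diagram. -/
def graph (D : DirectedDiagram) : SimpleGraph (D.Leg ⊕ D.Ver) :=
  SimpleGraph.fromRel fun p q => ∃ h, vertex h = p ∧ vertex (D.opp h) = q

/-- The whole diagram, circle included, is connected: every internal vertex is joined to the circle
by a path.  This needs no assumption, it follows from legality. -/
theorem exists_reachable_leg (D : DirectedDiagram) (v : D.Ver) :
    ∃ x : D.Leg, D.graph.Reachable (Sum.inr v) (Sum.inl x) := by
  by_contra hno
  push Not at hno
  have hstep : ∀ h : HalfEdge D.Leg D.Ver, D.graph.Reachable (Sum.inr v) (vertex h) →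
      D.graph.Reachable (Sum.inr v) (vertex (D.opp h)) := by
    intro h hh
    by_cases he : vertex h = vertex (D.opp h)
    · rwa [← he]
    · refine hh.trans (SimpleGraph.Adj.reachable ?_)
      rw [graph, SimpleGraph.fromRel_adj]
      exact ⟨he, Or.inl ⟨h, rfl, rfl⟩⟩
  have key : ∀ p : {w : D.Ver // D.graph.Reachable (Sum.inr v) (Sum.inr w)} × Bool,
      ∃ w : {w : D.Ver // D.graph.Reachable (Sum.inr v) (Sum.inr w)},
        D.opp (out p.1.1 p.2) = inn w.1 := by
    rintro ⟨⟨w, hw⟩, c⟩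
    have h1 := hstep (out w c) hw
    have h2 := D.isHead_opp (out w c)
    rcases h3 : D.opp (out w c) with x | w' | ⟨w', c'⟩
    · rw [h3] at h1
      exact absurd h1 (hno x)
    · rw [h3] at h1
      exact ⟨⟨w', h1⟩, rfl⟩
    · rw [h3] at h2
      simp [isHead, HalfEdge.isHead] at h2
  choose φ hφ using key
  have hinj : Function.Injective φ := by
    rintro ⟨⟨w, hw⟩, c⟩ ⟨⟨w', hw'⟩, c'⟩ he
    have h1 := hφ (⟨w, hw⟩, c)
    have h2 := hφ (⟨w', hw'⟩, c')
    rw [he, ← h2] at h1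
    have h3 := congrArg D.opp h1
    simp only [D.opp_opp] at h3
    cases h3
    rfl
  have := D.finite_ver
  have hc := Nat.card_le_card_of_injective φ hinj
  have : Nonempty {w : D.Ver // D.graph.Reachable (Sum.inr v) (Sum.inr w)} :=
    ⟨⟨v, SimpleGraph.Reachable.refl _⟩⟩
  have hpos : 0 < Nat.card {w : D.Ver // D.graph.Reachable (Sum.inr v) (Sum.inr w)} :=
    Nat.card_pos
  rw [Nat.card_prod] at hc
  simp at hc

/-- The degree: `+1` for every edge (an edge is counted through its head) and `-1` for every
internal vertex. -/
noncomputable def degree (D : DirectedDiagram) : ℤ :=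
  (Nat.card {h : HalfEdge D.Leg D.Ver // D.isHead h = true} : ℤ) - (Nat.card D.Ver : ℤ)

/-- A primitive diagram: it is nonempty and stays connected when the base circle is removed. -/
def IsPrimitive (D : DirectedDiagram) : Prop := D.graph.Connected

/-- Two diagrams are the same: there is an isomorphism of graphs preserving the cyclic order along
the circle, the arrows and the orientations of the internal vertices. -/
def Iso (D E : DirectedDiagram) : Prop :=
  ∃ (f : D.Leg ≃ E.Leg) (g : D.Ver ≃ E.Ver),
    D.circle.map f = E.circle ∧
    (∀ x, E.inward (f x) = D.inward x) ∧
    (∀ h, E.opp (HalfEdge.map f g h) = HalfEdge.map f g (D.opp h))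

/-- The edge that ended in the half-edge `h` is made to end in `σ h`. -/
def reglue (D : DirectedDiagram) (σ : Equiv.Perm (HalfEdge D.Leg D.Ver))
    (hσ : ∀ h, D.isHead (σ h) = D.isHead h) : DirectedDiagram :=
  { D with
    opp := fun h => σ (D.opp (σ.symm h))
    opp_opp := fun h => by simp [D.opp_opp]
    opp_head := fun h => by
      change D.isHead (σ (D.opp (σ.symm h))) = !D.isHead h
      rw [hσ, D.isHead_opp, ← hσ (σ.symm h), Equiv.apply_symm_apply] }

open Classical in
theorem isHead_swap (D : DirectedDiagram) {p q : HalfEdge D.Leg D.Ver}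
    (hpq : D.isHead p = D.isHead q) (h : HalfEdge D.Leg D.Ver) :
    D.isHead (Equiv.swap p q h) = D.isHead h := by
  by_cases h1 : h = p
  · subst h1; rw [Equiv.swap_apply_left, hpq]
  · by_cases h2 : h = q
    · subst h2; rw [Equiv.swap_apply_right, hpq]
    · rw [Equiv.swap_apply_of_ne_of_ne h1 h2]

open Classical in
/-- Reversal of the orientation of the internal vertex `v`. -/
noncomputable def flip (D : DirectedDiagram) (v : D.Ver) : DirectedDiagram :=
  D.reglue (Equiv.swap (out v false) (out v true)) (D.isHead_swap rfl)

open Classical in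
/-- For an edge from `v` (leaving as `out v c`) to `w`: the cyclic permutation
`out v (!c) → out w false → out w true → out v (!c)` of the other three outgoing half-edges. -/
noncomputable def rotation (D : DirectedDiagram) (v w : D.Ver) (c : Bool) :
    Equiv.Perm (HalfEdge D.Leg D.Ver) :=
  Equiv.swap (out v (!c)) (out w false) * Equiv.swap (out w false) (out w true)

theorem isHead_rotation (D : DirectedDiagram) (v w : D.Ver) (c : Bool)
    (h : HalfEdge D.Leg D.Ver) : D.isHead (D.rotation v w c h) = D.isHead h := by
  rw [rotation, Equiv.Perm.mul_apply]
  exact (D.isHead_swap (p := out v (!c)) (q := out w false) rfl _).trans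
    (D.isHead_swap (p := out w false) (q := out w true) rfl h)

/-- The second diagram of the IHX relation at an edge from `v` to `w`. -/
noncomputable def ihxSecond (D : DirectedDiagram) (v w : D.Ver) (c : Bool) : DirectedDiagram :=
  D.reglue (D.rotation v w c) (D.isHead_rotation v w c)

/-- The third diagram of the IHX relation at an edge from `v` to `w`. -/
noncomputable def ihxThird (D : DirectedDiagram) (v w : D.Ver) (c : Bool) : DirectedDiagram :=
  D.reglue (D.rotation v w c * D.rotation v w c)
    (fun h => by rw [Equiv.Perm.mul_apply, D.isHead_rotation, D.isHead_rotation])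

open Classical in
/-- The diagram in which the external vertices `a` and `b` have exchanged their places on the
circle (their edges and arrows are kept). -/
noncomputable def swapLegs (D : DirectedDiagram) (a b : D.Leg) : DirectedDiagram :=
  { D with
    circle := D.circle.map (Equiv.swap a b)
    nodup := by
      have hn := D.nodup
      revert hn
      refine Quotient.inductionOn' D.circle ?_
      intro l hl
      exact List.Nodup.map (Equiv.injective _) hl
    mem_circle := fun x =>
      Cycle.mem_map.2 ⟨Equiv.swap a b x, D.mem_circle _, Equiv.swap_apply_self a b x⟩ }

/-- `IsResolution U S a b l`: along the circle `S` has the neighbouring external vertices `a, b`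
followed by `l`, and `U` is the diagram in which the two edges ending in `a` and `b` end instead in
a new internal vertex `v`, whose third half-edge is joined to one external vertex `s` in the place of
`a` and `b`.  With the circle drawn counterclockwise and the edges inside it, the counterclockwise
order at `v` is: stem, edge of `b`, edge of `a`.  The map `ι` identifies the half-edges of `S` with
those half-edges of `U` that do not belong to the stem, and it keeps the arrows; the arrow of the
stem is then determined by the legality of `v`. -/
def IsResolution (U S : DirectedDiagram) (a b : S.Leg) (l : List S.Leg) : Prop :=
  S.circle = ((a :: b :: l : List S.Leg) : Cycle S.Leg) ∧
  ∃ (s : U.Leg) (v : U.Ver) (k : Fin 3) (f : S.Leg → U.Leg) (g : S.Ver → U.Ver)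
    (ι : HalfEdge S.Leg S.Ver → HalfEdge U.Leg U.Ver),
    U.circle = ((s :: l.map f : List U.Leg) : Cycle U.Leg) ∧
    Function.Injective g ∧ Set.range g = {v}ᶜ ∧
    U.opp (leg s) = corner v k ∧
    ι (leg b) = corner v (k + 1) ∧ ι (leg a) = corner v (k + 2) ∧
    (∀ x ∈ l, ι (leg x) = leg (f x)) ∧
    (∀ w, ι (inn w) = inn (g w)) ∧ (∀ w c, ι (out w c) = out (g w) c) ∧
    (∀ h, U.opp (ι h) = ι (S.opp h)) ∧
    (∀ h, U.isHead (ι h) = S.isHead h)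

/-- The diagram without any edge (the bare circle). -/
def empty : DirectedDiagram where
  Leg := Empty
  Ver := Empty
  finite_ver := inferInstance
  circle := Cycle.nil
  nodup := by simp
  mem_circle := fun x => x.elim
  inward := fun x => x.elim
  opp := id
  opp_opp := fun _ => rfl
  opp_head := fun h => by rcases h with x | v | ⟨v, c⟩ <;> exact Empty.elim ‹_›

/-- The directed single chord diagram. -/
def theta : DirectedDiagram where
  Leg := Bool
  Ver := Empty
  finite_ver := inferInstance
  circle := (([false, true] : List Bool) : Cycle Bool)
  nodup := by simp
  mem_circle := fun x => by cases x <;> simp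
  inward := id
  opp := fun h => match h with
    | .leg x => .leg (!x)
    | .inn v => v.elim
    | .out v _ => v.elim
  opp_opp := fun h => by
    rcases h with x | v | ⟨v, c⟩
    · simp
    · exact v.elim
    · exact v.elim
  opp_head := fun h => by
    rcases h with x | v | ⟨v, c⟩
    · rfl
    · exact v.elim
    · exact v.elim

/-- The connected sum of `D` and `E` along the circle, where the circle of `D` is cut open so that
its external vertices form the sequence `l`, and that of `E` so that they form the sequence `m`. -/
def connectedSum (D E : DirectedDiagram) (l : List D.Leg) (m : List E.Leg)
    (hl : D.circle = (l : Cycle D.Leg)) (hm : E.circle = (m : Cycle E.Leg)) :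
    DirectedDiagram where
  Leg := D.Leg ⊕ E.Leg
  Ver := D.Ver ⊕ E.Ver
  finite_ver := by
    have := D.finite_ver
    have := E.finite_ver
    infer_instance
  circle := ((l.map Sum.inl ++ m.map Sum.inr : List (D.Leg ⊕ E.Leg)) : Cycle (D.Leg ⊕ E.Leg))
  nodup := by
    have h1 := D.nodup
    have h2 := E.nodup
    rw [hl, Cycle.nodup_coe_iff] at h1
    rw [hm, Cycle.nodup_coe_iff] at h2
    rw [Cycle.nodup_coe_iff, List.nodup_append]
    refine ⟨h1.map Sum.inl_injective, h2.map Sum.inr_injective, ?_⟩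
    intro x hx y hy hxy
    simp only [List.mem_map] at hx hy
    obtain ⟨x', _, rfl⟩ := hx
    obtain ⟨y', _, rfl⟩ := hy
    cases hxy
  mem_circle := fun x => by
    have h1 := D.mem_circle
    have h2 := E.mem_circle
    rw [hl] at h1
    rw [hm] at h2
    rw [Cycle.mem_coe_iff, List.mem_append]
    rcases x with x | x
    · exact Or.inl (List.mem_map.2 ⟨x, h1 x, rfl⟩)
    · exact Or.inr (List.mem_map.2 ⟨x, h2 x, rfl⟩)
  inward := Sum.elim D.inward E.inward
  opp := fun h => match h with
    | .leg (.inl x) => (D.opp (.leg x)).map Sum.inl Sum.inl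
    | .leg (.inr x) => (E.opp (.leg x)).map Sum.inr Sum.inr
    | .inn (.inl v) => (D.opp (.inn v)).map Sum.inl Sum.inl
    | .inn (.inr v) => (E.opp (.inn v)).map Sum.inr Sum.inr
    | .out (.inl v) c => (D.opp (.out v c)).map Sum.inl Sum.inl
    | .out (.inr v) c => (E.opp (.out v c)).map Sum.inr Sum.inr
  opp_opp := fun h => by
    rcases h with (x | x) | (v | v) | ⟨v | v, c⟩
    · have := D.opp_opp (.leg x)
      rcases h3 : D.opp (.leg x) with y | y | ⟨y, d⟩ <;> rw [h3] at this <;>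
        simp [HalfEdge.map, this, h3]
    · have := E.opp_opp (.leg x)
      rcases h3 : E.opp (.leg x) with y | y | ⟨y, d⟩ <;> rw [h3] at this <;>
        simp [HalfEdge.map, this, h3]
    · have := D.opp_opp (.inn v)
      rcases h3 : D.opp (.inn v) with y | y | ⟨y, d⟩ <;> rw [h3] at this <;>
        simp [HalfEdge.map, this, h3]
    · have := E.opp_opp (.inn v)
      rcases h3 : E.opp (.inn v) with y | y | ⟨y, d⟩ <;> rw [h3] at this <;>
        simp [HalfEdge.map, this, h3]
    · have := D.opp_opp (.out v c)
      rcases h3 : D.opp (.out v c) with y | y | ⟨y, d⟩ <;> rw [h3] at this <;>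
        simp [HalfEdge.map, this, h3]
    · have := E.opp_opp (.out v c)
      rcases h3 : E.opp (.out v c) with y | y | ⟨y, d⟩ <;> rw [h3] at this <;>
        simp [HalfEdge.map, this, h3]
  opp_head := fun h => by
    rcases h with (x | x) | (v | v) | ⟨v | v, c⟩
    · have := D.isHead_opp (.leg x)
      rcases h3 : D.opp (.leg x) with y | y | ⟨y, d⟩ <;> rw [h3] at this <;>
        simp_all [HalfEdge.map, isHead, HalfEdge.isHead]
    · have := E.isHead_opp (.leg x)
      rcases h3 : E.opp (.leg x) with y | y | ⟨y, d⟩ <;> rw [h3] at this <;>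
        simp_all [HalfEdge.map, isHead, HalfEdge.isHead]
    · have := D.isHead_opp (.inn v)
      rcases h3 : D.opp (.inn v) with y | y | ⟨y, d⟩ <;> rw [h3] at this <;>
        simp_all [HalfEdge.map, isHead, HalfEdge.isHead]
    · have := E.isHead_opp (.inn v)
      rcases h3 : E.opp (.inn v) with y | y | ⟨y, d⟩ <;> rw [h3] at this <;>
        simp_all [HalfEdge.map, isHead, HalfEdge.isHead]
    · have := D.isHead_opp (.out v c)
      rcases h3 : D.opp (.out v c) with y | y | ⟨y, d⟩ <;> rw [h3] at this <;>
        simp_all [HalfEdge.map, isHead, HalfEdge.isHead]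
    · have := E.isHead_opp (.out v c)
      rcases h3 : E.opp (.out v c) with y | y | ⟨y, d⟩ <;> rw [h3] at this <;>
        simp_all [HalfEdge.map, isHead, HalfEdge.isHead]

/-- The generator of the free vector space on diagrams that belongs to `D`. -/
noncomputable def gen (D : DirectedDiagram) : DirectedDiagram →₀ ℂ := Finsupp.single D 1

/-- The relations of the space of directed diagrams. -/
inductive Relation : (DirectedDiagram →₀ ℂ) → Prop
  /-- isomorphic diagrams are equal -/
  | iso (D E : DirectedDiagram) (h : Iso D E) : Relation (gen D - gen E)
  /-- directed AS: reversing the orientation of a vertex changes the sign -/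
  | antisymmetry (D : DirectedDiagram) (v : D.Ver) : Relation (gen D + gen (D.flip v))
  /-- directed IHX in its cyclic (Jacobi) form: of the four other half-edges at the two ends of an
  edge one is ingoing and three are outgoing; the sum over the cyclic permutations of the
  outgoing ones vanishes -/
  | ihx (D : DirectedDiagram) (v w : D.Ver) (c : Bool) (hvw : v ≠ w)
      (h : D.opp (out v c) = inn w) :
      Relation (gen D + gen (D.ihxSecond v w c) + gen (D.ihxThird v w c))
  /-- directed STU, when not both arrows point towards the circle: `S - T = U` -/
  | stu (U S : DirectedDiagram) (a b : S.Leg) (l : List S.Leg) (h : IsResolution U S a b l) :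
      Relation (gen S - gen (S.swapLegs a b) - gen U)
  /-- directed STU, when both arrows point towards the circle: `S - T = 0` -/
  | stuInward (S : DirectedDiagram) (a b : S.Leg) (l : List S.Leg)
      (h : S.circle = ((a :: b :: l : List S.Leg) : Cycle S.Leg))
      (ha : S.inward a = true) (hb : S.inward b = true) :
      Relation (gen S - gen (S.swapLegs a b))

end DirectedDiagram

open DirectedDiagram in
/-- The space of legally directed diagrams on a circle modulo directed STU, IHX and AS. -/
abbrev DirectedAlgebra : Type 1 :=
  (DirectedDiagram →₀ ℂ) ⧸ Submodule.span ℂ {r : DirectedDiagram →₀ ℂ | Relation r}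

namespace DirectedDiagram

/-- The class of a diagram. -/
noncomputable def cls (D : DirectedDiagram) : DirectedAlgebra :=
  Submodule.Quotient.mk (gen D)

/-- The part of degree `n`. -/
noncomputable def degreePart (n : ℕ) : Submodule ℂ DirectedAlgebra :=
  Submodule.span ℂ {x | ∃ D : DirectedDiagram, D.degree = (n : ℤ) ∧ x = cls D}

/-- The space of primitive elements of degree `n`. -/
noncomputable def primitivePart (n : ℕ) : Submodule ℂ DirectedAlgebra :=
  Submodule.span ℂ {x | ∃ D : DirectedDiagram, D.IsPrimitive ∧ D.degree = (n : ℤ) ∧ x = cls D}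

/-- A bilinear product on the space of directed diagrams is the connected sum product if it sends
the classes of two diagrams to the class of their connected sum, wherever the circles are cut. -/
def IsConnectedSumProduct
    (μ : DirectedAlgebra →ₗ[ℂ] DirectedAlgebra →ₗ[ℂ] DirectedAlgebra) : Prop :=
  ∀ (D E : DirectedDiagram) (l : List D.Leg) (m : List E.Leg)
    (hl : D.circle = (l : Cycle D.Leg)) (hm : E.circle = (m : Cycle E.Leg)),
    μ (cls D) (cls E) = cls (connectedSum D E l m hl hm)

/-- The `n`-th power of the class of the single chord with respect to the product `μ`, with the
class of the bare circle as its zeroth power. -/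
noncomputable def thetaPow
    (μ : DirectedAlgebra →ₗ[ℂ] DirectedAlgebra →ₗ[ℂ] DirectedAlgebra) :
    ℕ → DirectedAlgebra
  | 0 => cls empty
  | n + 1 => μ (cls theta) (thetaPow μ n)

end DirectedDiagram

/-!
The whole statement follows from one fact, `DirectedDiagram.cls_eq_zero_of_nonempty_ver`: a diagram
with an internal vertex has class zero.  It is proved by strong induction on the number `N` of
external vertices.

* Every diagram on the right-hand side of an STU relation has an internal vertex and one external
  vertex less, so by induction all external vertices of a diagram with at most `N` of them may be
  permuted freely (`exchangeable_of_resolution`, `cls_recircle_eq_of_perm`).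
* Hence a diagram vanishes if both edges leaving some internal vertex end on the circle (a cherry):
  exchanging the two ends amounts to reversing the orientation of the vertex
  (`cls_eq_zero_of_cherry`).
* If there is no cherry, then, since one edge enters and two edges leave each vertex, the
  pigeonhole principle shows that the diagram consists of chords and directed wheels whose spokes
  point to the circle (`wheels_of_no_cherry`).  In particular a diagram in which some edge leads from
  the circle to an internal vertex has a cherry, and so vanishes.
* A wheel is cut open at a vertex `v` next to the circle (`exists_cut`): the diagram becomes the
  difference `S - T`, where the wheel is replaced by a path from an external vertex `p` to a
  neighbouring one `q`, and `S`, `T` differ by the order of `p` and `q`.  Carrying `q` around the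
  circle the long way turns `S` into `T` (`cls_recircle_around`).  Passing another external vertex
  gives a correction with `N` external vertices in which the edge starting at `p` ends at an internal
  vertex, so the correction is zero.

It follows that all diagrams of `n` chords without internal vertices have the same class
(`cls_eq_cls_chords`).  The number of chords is an invariant that is compatible with all relations
when diagrams with internal vertices are sent to zero, which gives linear maps between the algebra
and the polynomial ring in both directions.  The connected sum product is the product of polynomials
transported along them (`isConnectedSumProduct_product`), and a primitive diagram without internal
vertices is a single chord (`IsPrimitive.iso_theta`).
-/

namespace DirectedDiagram

open HalfEdge

/-! ### The relations as equations between classes -/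

theorem finite_leg (D : DirectedDiagram) : Finite D.Leg := by
  obtain ⟨l, hl⟩ := Quotient.exists_rep D.circle
  refine Set.finite_univ_iff.1 ((List.finite_toSet l).subset fun x _ => ?_)
  have := D.mem_circle x
  rw [← hl] at this
  exact this

theorem opp_injective (D : DirectedDiagram) : Function.Injective D.opp :=
  Function.LeftInverse.injective D.opp_opp

theorem mk_eq_zero_of_relation {r : DirectedDiagram →₀ ℂ} (h : Relation r) :
    (Submodule.Quotient.mk r : DirectedAlgebra) = 0 :=
  (Submodule.Quotient.mk_eq_zero _).2 (Submodule.subset_span h)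

theorem cls_eq_of_iso {D E : DirectedDiagram} (h : D.Iso E) : D.cls = E.cls := by
  have := mk_eq_zero_of_relation (Relation.iso D E h)
  rw [Submodule.Quotient.mk_sub, sub_eq_zero] at this
  exact this

theorem cls_flip (D : DirectedDiagram) (v : D.Ver) : (D.flip v).cls = -D.cls := by
  have := mk_eq_zero_of_relation (Relation.antisymmetry D v)
  rw [Submodule.Quotient.mk_add] at this
  exact eq_neg_of_add_eq_zero_right this

theorem cls_sub_cls_swapLegs {U S : DirectedDiagram} {a b : S.Leg} {l : List S.Leg}
    (h : IsResolution U S a b l) : S.cls - (S.swapLegs a b).cls = U.cls := by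
  have := mk_eq_zero_of_relation (Relation.stu U S a b l h)
  rw [Submodule.Quotient.mk_sub, Submodule.Quotient.mk_sub, sub_eq_zero] at this
  exact this

theorem cls_swapLegs_of_inward {S : DirectedDiagram} {a b : S.Leg} {l : List S.Leg}
    (h : S.circle = ((a :: b :: l : List S.Leg) : Cycle S.Leg))
    (ha : S.inward a = true) (hb : S.inward b = true) : S.cls = (S.swapLegs a b).cls := by
  have := mk_eq_zero_of_relation (Relation.stuInward S a b l h ha hb)
  rw [Submodule.Quotient.mk_sub, sub_eq_zero] at this
  exact this

/-! ### Rearranging the external vertices on the circle -/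

/-- The diagram `D` with its external vertices put on the circle in the order given by the list
`l`; edges and arrows are kept. -/
def recircle (D : DirectedDiagram) (l : List D.Leg) (h : l.Nodup ∧ ∀ x, x ∈ l) :
    DirectedDiagram :=
  { D with
    circle := (l : Cycle D.Leg)
    nodup := Cycle.nodup_coe_iff.2 h.1
    mem_circle := fun x => Cycle.mem_coe_iff.2 (h.2 x) }

theorem exists_circle_eq (D : DirectedDiagram) :
    ∃ l : List D.Leg, D.circle = (l : Cycle D.Leg) ∧ l.Nodup ∧ ∀ x, x ∈ l := by
  obtain ⟨l, hl⟩ := Quotient.exists_rep D.circle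
  have hn := D.nodup
  have hm := D.mem_circle
  rw [← hl] at hn hm
  exact ⟨l, hl.symm, hn, hm⟩

theorem recircle_self (D : DirectedDiagram) {l : List D.Leg} (h : l.Nodup ∧ ∀ x, x ∈ l)
    (hc : D.circle = (l : Cycle D.Leg)) : D.recircle l h = D := by
  unfold recircle
  simp only [← hc]

theorem card_leg (D : DirectedDiagram) {l : List D.Leg} (hc : D.circle = (l : Cycle D.Leg)) :
    Nat.card D.Leg = l.length := by
  classical
  have hn := D.nodup
  have hm := D.mem_circle
  rw [hc] at hn hm
  rw [← Nat.card_congr (List.Nodup.getEquivOfForallMemList l hn hm), Nat.card_fin]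

theorem recircle_congr (D : DirectedDiagram) {l l' : List D.Leg} (h : l.Nodup ∧ ∀ x, x ∈ l)
    (h' : l'.Nodup ∧ ∀ x, x ∈ l') (e : (l : Cycle D.Leg) = l') :
    D.recircle l h = D.recircle l' h' := by
  unfold recircle
  congr 1

theorem perm_arrangement {L : Type} {l l' : List L} (hp : l.Perm l')
    (h : l.Nodup ∧ ∀ x, x ∈ l) : l'.Nodup ∧ ∀ x, x ∈ l' :=
  ⟨hp.nodup_iff.1 h.1, fun x => hp.mem_iff.1 (h.2 x)⟩

theorem arrangement_of_coe_eq {L : Type} {l l' : List L} (e : (l : Cycle L) = l')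
    (h : l.Nodup ∧ ∀ x, x ∈ l) : l'.Nodup ∧ ∀ x, x ∈ l' :=
  perm_arrangement (Cycle.coe_eq_coe.1 e).perm h

theorem coe_cons_append {L : Type} (x : L) (l t : List L) :
    ((x :: (l ++ t) : List L) : Cycle L) = ((l ++ (t ++ [x]) : List L) : Cycle L) := by
  rw [← List.append_assoc]
  exact Cycle.coe_cons_eq_coe_append (l ++ t) x

/-- In every arrangement of the external vertices of `D` in which `a` and `b` are neighbours, they
may be exchanged without changing the class. -/
def Exchangeable (D : DirectedDiagram) (a b : D.Leg) : Prop :=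
  ∀ l h h', (D.recircle (a :: b :: l) h).cls = (D.recircle (b :: a :: l) h').cls

theorem cls_recircle_eq_of_perm (D : DirectedDiagram) (hD : ∀ a b, D.Exchangeable a b)
    {l l' : List D.Leg} (hp : l.Perm l') (h h') :
    (D.recircle l h).cls = (D.recircle l' h').cls := by
  -- Generalised by a suffix `t`, so that a common first entry can be rotated to the end.
  suffices key : ∀ t h h', (D.recircle (l ++ t) h).cls = (D.recircle (l' ++ t) h').cls by
    simpa using key [] (by simpa using h) (by simpa using h')
  clear h h'
  induction hp with
  | nil => intro t h h'; rfl
  | cons x hp ih =>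
    intro t h h'
    have e1 := coe_cons_append x
    rw [D.recircle_congr h (arrangement_of_coe_eq (e1 _ _) h) (e1 _ _),
      D.recircle_congr h' (arrangement_of_coe_eq (e1 _ _) h') (e1 _ _)]
    exact ih _ _ _
  | swap x y l => intro t h h'; exact hD _ _ _ _ _
  | trans h1 h2 ih1 ih2 =>
    intro t h h'
    exact (ih1 t h (perm_arrangement (h1.append_right t) h)).trans (ih2 t _ h')

/-- An external vertex `q` that may pass every other one except `p` can be carried around the
circle from one side of `p` to the other. -/
theorem cls_recircle_around (D : DirectedDiagram) (p q : D.Leg)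
    (hq : ∀ y, y ≠ p → D.Exchangeable q y) (l : List D.Leg) (h h') :
    (D.recircle (p :: q :: l) h).cls = (D.recircle (q :: p :: l) h').cls := by
  have key : ∀ m t : List D.Leg, p ∉ m → ∀ h h',
      (D.recircle (q :: (m ++ t)) h).cls = (D.recircle (m ++ q :: t) h').cls := by
    intro m
    induction m with
    | nil => intro t _ h h'; rfl
    | cons y m ih =>
      intro t hp h h'
      rw [List.mem_cons, not_or] at hp
      have e1 : ((y :: q :: (m ++ t) : List D.Leg) : Cycle D.Leg) =
          ((q :: (m ++ (t ++ [y])) : List D.Leg) : Cycle D.Leg) :=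
        coe_cons_append y (q :: m) t
      have e2 : ((y :: (m ++ q :: t) : List D.Leg) : Cycle D.Leg) =
          ((m ++ q :: (t ++ [y]) : List D.Leg) : Cycle D.Leg) :=
        coe_cons_append y m (q :: t)
      have h1 := perm_arrangement (List.Perm.swap y q (m ++ t)) h
      rw [D.recircle_congr h' (arrangement_of_coe_eq e2 h') e2,
        ← ih _ hp.2 (arrangement_of_coe_eq e1 h1), ← D.recircle_congr h1 _ e1]
      exact hq y (Ne.symm hp.1) _ _ _
  have hp : p ∉ l := fun hp => (List.nodup_cons.1 h.1).1 (List.mem_cons_of_mem q hp)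
  have e1 : ((p :: q :: l : List D.Leg) : Cycle D.Leg) =
      ((q :: (l ++ [p]) : List D.Leg) : Cycle D.Leg) := coe_cons_append p [q] l
  have e2 : ((q :: p :: l : List D.Leg) : Cycle D.Leg) =
      ((l ++ [q, p] : List D.Leg) : Cycle D.Leg) :=
    (coe_cons_append q [p] l).trans (coe_cons_append p l [q])
  rw [D.recircle_congr h (arrangement_of_coe_eq e1 h) e1,
    D.recircle_congr h' (arrangement_of_coe_eq e2 h') e2]
  exact key l [p] hp _ _

theorem swapLegs_eq_recircle (D : DirectedDiagram) {a b : D.Leg} {l : List D.Leg}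
    (hc : D.circle = ((a :: b :: l : List D.Leg) : Cycle D.Leg)) (h') :
    D.swapLegs a b = D.recircle (b :: a :: l) h' := by
  classical
  unfold swapLegs recircle
  have hl : l.map (Equiv.swap a b) = l := by
    refine (List.map_congr_left fun x hx => ?_).trans (List.map_id l)
    have := h'.1
    exact Equiv.swap_apply_of_ne_of_ne (by grind) (by grind)
  congr 1
  rw [hc, Cycle.map_coe]
  simp only [List.map_cons, Equiv.swap_apply_left, Equiv.swap_apply_right]
  convert rfl using 4
  convert hl.symm

/-! ### Resolving two neighbouring external vertices, and cutting at an internal vertex -/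

/-- An edge pairing can be pulled back along an injection of half-edges whose range is closed under
the pairing. -/
theorem exists_opp {L V T : Type} (inward : L → Bool) (e : HalfEdge L V → T)
    (he : Function.Injective e) (J : T → T) (hJ : ∀ t, J (J t) = t) (head : T → Bool)
    (hhead : ∀ t, head (J t) = !head t) (hin : ∀ h, head (e h) = HalfEdge.isHead inward h)
    (hr : ∀ h, ∃ h', e h' = J (e h)) :
    ∃ opp : HalfEdge L V → HalfEdge L V, (∀ h, opp (opp h) = h) ∧
      (∀ h, HalfEdge.isHead inward (opp h) = !HalfEdge.isHead inward h) ∧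
      ∀ h, e (opp h) = J (e h) := by
  choose opp hopp using hr
  refine ⟨opp, fun h => he ?_, fun h => ?_, hopp⟩
  · rw [hopp, hopp, hJ]
  · rw [← hin, hopp, hhead, hin]

theorem corner_positions (k : Fin 3) : k + 1 ≠ k ∧ k + 2 ≠ k ∧ k + 2 ≠ k + 1 ∧
    ∀ j : Fin 3, j = k ∨ j = k + 1 ∨ j = k + 2 := by
  decide +revert

theorem corner_inj {L V : Type} {w w' : V} {i j : Fin 3}
    (h : (corner w i : HalfEdge L V) = corner w' j) : w = w' ∧ i = j := by
  fin_cases i <;> fin_cases j <;> cases h <;> exact ⟨rfl, rfl⟩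

theorem corner_ne_leg {L V : Type} (w : V) (i : Fin 3) (x : L) :
    (corner w i : HalfEdge L V) ≠ leg x := by
  intro h
  fin_cases i <;> cases h

theorem eq_leg_or_eq_corner {L V : Type} (h : HalfEdge L V) :
    (∃ x, h = leg x) ∨ ∃ w j, h = corner w j := by
  rcases h with x | w | ⟨w, _ | _⟩
  · exact Or.inl ⟨x, rfl⟩
  · exact Or.inr ⟨w, 0, rfl⟩
  · exact Or.inr ⟨w, 1, rfl⟩
  · exact Or.inr ⟨w, 2, rfl⟩

theorem isHead_corner (D : DirectedDiagram) (v : D.Ver) (k : Fin 3) :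
    D.isHead (corner v k) = decide (k = 0) := by
  fin_cases k <;> rfl

/-- Two neighbouring external vertices that do not both lie at heads can be joined to a new
internal vertex: the right-hand side of the STU relation exists. -/
theorem exists_resolution (S : DirectedDiagram) (a b : S.Leg) (l : List S.Leg)
    (hc : S.circle = ((a :: b :: l : List S.Leg) : Cycle S.Leg))
    (hab : ¬ (S.inward a = true ∧ S.inward b = true)) :
    ∃ U : DirectedDiagram, IsResolution U S a b l := by
  classical
  have hfin := S.finite_ver
  have hnd := S.nodup
  have hmem := S.mem_circle
  rw [hc] at hmem
  rw [hc, Cycle.nodup_coe_iff, List.nodup_cons, List.nodup_cons] at hnd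
  simp only [Cycle.mem_coe_iff, List.mem_cons] at hmem
  obtain ⟨ha, hb, hl⟩ := hnd
  have hne : a ≠ b := fun h => ha (by simp [h])
  have hal : a ∉ l := fun h => ha (List.mem_cons_of_mem b h)
  -- The position of the stem among the three corners is forced by the arrows at `a` and `b`.
  obtain ⟨k, hka, hkb⟩ : ∃ k : Fin 3,
      decide (k + 2 = 0) = S.inward a ∧ decide (k + 1 = 0) = S.inward b := by
    cases h1 : S.inward a <;> cases h2 : S.inward b
    · exact ⟨0, by decide⟩
    · exact ⟨2, by decide⟩
    · exact ⟨1, by decide⟩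
    · exact absurd ⟨h1, h2⟩ hab
  -- The half-edges of the new diagram: those of `S`, and the two ends of the stem.  The external
  -- vertex `a` is reused as the outer end of the stem (`true`); the new internal vertex is `none`.
  let at_ : Fin 3 → HalfEdge S.Leg S.Ver ⊕ Bool := fun j =>
    if j = k then Sum.inr false else if j = k + 1 then Sum.inl (leg b) else Sum.inl (leg a)
  let e : HalfEdge {x : S.Leg // x ≠ b} (Option S.Ver) → HalfEdge S.Leg S.Ver ⊕ Bool
    | leg x => if x.1 = a then Sum.inr true else Sum.inl (leg x.1)
    | inn (some w) => Sum.inl (inn w)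
    | out (some w) c => Sum.inl (out w c)
    | inn none => at_ 0
    | out none false => at_ 1
    | out none true => at_ 2
  have hcorner : ∀ j, e (corner none j) = at_ j := by
    intro j; fin_cases j <;> rfl
  obtain ⟨hk1, hk2, hk3, hk⟩ := corner_positions k
  have hat0 : at_ k = Sum.inr false := by simp [at_]
  have hat1 : at_ (k + 1) = Sum.inl (leg b) := by simp [at_]
  have hat2 : at_ (k + 2) = Sum.inl (leg a) := by simp only [at_, if_neg hk2, if_neg hk3]
  -- The inverse of `e`.
  let e' : HalfEdge S.Leg S.Ver ⊕ Bool → HalfEdge {x : S.Leg // x ≠ b} (Option S.Ver)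
    | Sum.inr true => leg ⟨a, hne⟩
    | Sum.inr false => corner none k
    | Sum.inl (leg x) =>
      if hx : x = b then corner none (k + 1) else if x = a then corner none (k + 2)
        else leg ⟨x, hx⟩
    | Sum.inl (inn w) => inn (some w)
    | Sum.inl (out w c) => out (some w) c
  have hee' : ∀ t, e (e' t) = t := by
    rintro ((x | w | ⟨w, c⟩) | (_ | _))
    · by_cases hxb : x = b
      · simp only [e', dif_pos hxb]; rw [hcorner, hat1, hxb]
      · by_cases hxa : x = a
        · simp only [e', dif_neg hxb, if_pos hxa]; rw [hcorner, hat2, hxa]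
        · simp only [e', dif_neg hxb, if_neg hxa]; simp [e, hxa]
    · rfl
    · rfl
    · exact (hcorner k).trans hat0
    · simp [e', e]
  have he'c : ∀ j, e' (at_ j) = corner none j := by
    intro j
    rcases hk j with rfl | rfl | rfl
    · rw [hat0]
    · rw [hat1]; simp [e']
    · rw [hat2]; simp [e', hne]
  have he'e : ∀ h, e' (e h) = h := by
    rintro (x | (_ | w) | ⟨_ | w, c⟩)
    · by_cases hxa : x.1 = a
      · simp only [e, if_pos hxa, e']; simp [← hxa]
      · simp only [e, if_neg hxa, e', dif_neg x.2]
    · exact he'c 0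
    · rfl
    · cases c
      · exact he'c 1
      · exact he'c 2
    · rfl
  have hinj : Function.Injective e := Function.LeftInverse.injective he'e
  let inward : {x : S.Leg // x ≠ b} → Bool := fun x =>
    if x.1 = a then !decide (k = 0) else S.inward x.1
  let J : HalfEdge S.Leg S.Ver ⊕ Bool → HalfEdge S.Leg S.Ver ⊕ Bool := Sum.map S.opp not
  let head : HalfEdge S.Leg S.Ver ⊕ Bool → Bool
    | Sum.inl h => S.isHead h
    | Sum.inr true => !decide (k = 0)
    | Sum.inr false => decide (k = 0)
  have hheadat : ∀ j, head (at_ j) = decide (j = 0) := by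
    intro j
    rcases hk j with rfl | rfl | rfl
    · rw [hat0]
    · rw [hat1]; exact hkb.symm
    · rw [hat2]; exact hka.symm
  have hin : ∀ h, head (e h) = HalfEdge.isHead inward h := by
    rintro (x | (_ | w) | ⟨_ | w, c⟩)
    · by_cases hxa : x.1 = a
      · simp only [e, if_pos hxa, head, HalfEdge.isHead, inward]
      · simp only [e, if_neg hxa, head, HalfEdge.isHead, inward]; rfl
    · exact hheadat 0
    · rfl
    · cases c
      · exact hheadat 1
      · exact hheadat 2
    · rfl
  obtain ⟨opp, h1, h2, h3⟩ := exists_opp inward e hinj J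
    (by rintro (h | (_ | _)) <;> simp [J, S.opp_opp]) head
    (by rintro (h | (_ | _)) <;> simp [J, head, S.isHead_opp]) hin
    (fun h => ⟨e' (J (e h)), hee' _⟩)
  let f : S.Leg → {x : S.Leg // x ≠ b} := fun x => if hx : x = b then ⟨a, hne⟩ else ⟨x, hx⟩
  have hf : ∀ x (hx : x ≠ b), f x = ⟨x, hx⟩ := fun x hx => by simp only [f, dif_neg hx]
  let U : DirectedDiagram :=
    { Leg := {x : S.Leg // x ≠ b}
      Ver := Option S.Ver
      finite_ver := inferInstance
      circle := (((⟨a, hne⟩ : {x : S.Leg // x ≠ b}) :: l.map f : List _) : Cycle _)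
      nodup := by
        have hlb : ∀ x ∈ l, x ≠ b := fun x hx h => hb (h ▸ hx)
        rw [Cycle.nodup_coe_iff, List.nodup_cons]
        constructor
        · intro h
          obtain ⟨x, hx, hxa⟩ := List.mem_map.1 h
          rw [hf x (hlb x hx)] at hxa
          cases congrArg Subtype.val hxa
          exact hal hx
        · refine List.Nodup.map_on (fun x hx y hy hxy => ?_) hl
          rw [hf x (hlb x hx), hf y (hlb y hy)] at hxy
          exact congrArg Subtype.val hxy
      mem_circle := by
        rintro ⟨x, hx⟩
        rw [Cycle.mem_coe_iff, List.mem_cons]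
        rcases hmem x with rfl | rfl | h
        · exact Or.inl rfl
        · exact absurd rfl hx
        · exact Or.inr (List.mem_map.2 ⟨x, h, hf x hx⟩)
      inward := inward
      opp := opp
      opp_opp := h1
      opp_head := h2 }
  refine ⟨U, hc, ⟨a, hne⟩, none, k, f, some, e' ∘ Sum.inl, rfl, Option.some_injective _, ?_,
    ?_, ?_, ?_, ?_, ?_, ?_, ?_, ?_⟩
  · ext w; cases w <;> simp
  · apply hinj
    change e (opp _) = _
    rw [h3, hcorner, hat0]
    simp [e, J]
  · simp [e']
  · simp [e', hne]
  · intro x hx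
    have hxb : x ≠ b := fun h => hb (h ▸ hx)
    have hxa : x ≠ a := fun h => hal (h ▸ hx)
    simp only [Function.comp, e', dif_neg hxb, if_neg hxa, hf x hxb]
  · intro w; rfl
  · intro w c; rfl
  · intro h
    apply hinj
    change e (opp _) = _
    rw [h3]
    simp only [Function.comp, hee']
    rfl
  · intro h
    change HalfEdge.isHead inward _ = _
    rw [← hin]
    simp only [Function.comp, hee', head]

/-- A diagram with an edge joining the external vertex `s` to the internal vertex `v` is the
right-hand side of an STU relation: remove that edge and let the two other edges at `v` end at the
place of `s` on the circle.  The map `ι` identifies the half-edges of `S` with those of `D` that do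
not belong to the removed edge. -/
theorem exists_cut (D : DirectedDiagram) (s : D.Leg) (v : D.Ver) (k : Fin 3)
    (hs : D.opp (leg s) = corner v k) :
    ∃ (S : DirectedDiagram) (a b : S.Leg) (l : List S.Leg), IsResolution D S a b l ∧
      Nat.card S.Leg = Nat.card D.Leg + 1 ∧
      S.inward a = decide (k + 2 = 0) ∧ S.inward b = decide (k + 1 = 0) ∧
      ∃ ι : HalfEdge S.Leg S.Ver → HalfEdge D.Leg D.Ver, Function.Injective ι ∧
        (∀ h, D.opp (ι h) = ι (S.opp h)) ∧
        ι (leg b) = corner v (k + 1) ∧ ι (leg a) = corner v (k + 2) ∧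
        (∀ x, ι (leg x) ≠ corner v (k + 1) → ι (leg x) ≠ corner v (k + 2) →
          ∃ y, ι (leg x) = leg y) := by
  classical
  have hfin := D.finite_ver
  have hfinL := D.finite_leg
  have hv := D.opp_opp (leg s)
  rw [hs] at hv
  obtain ⟨l, hl⟩ : ∃ l : List D.Leg, D.circle = ((s :: l : List D.Leg) : Cycle D.Leg) := by
    obtain ⟨m, hm⟩ := Quotient.exists_rep D.circle
    have h := D.mem_circle s
    rw [← hm] at h
    obtain ⟨m1, m2, rfl⟩ := List.append_of_mem (show s ∈ m from h)
    refine ⟨m2 ++ m1, ?_⟩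
    rw [← hm]
    exact Cycle.coe_eq_coe.2 (List.isRotated_append (l := m1) (l' := s :: m2))
  have hnd := D.nodup
  rw [hl, Cycle.nodup_coe_iff] at hnd
  have hmem := D.mem_circle
  rw [hl] at hmem
  obtain ⟨hk1, hk2, hk3, hk⟩ := corner_positions k
  -- The place of `s` on the circle is taken by `a = none` and `b = some s`.
  let legι : Option D.Leg → HalfEdge D.Leg D.Ver
    | none => corner v (k + 2)
    | some x => if x = s then corner v (k + 1) else leg x
  let ι : HalfEdge (Option D.Leg) {w : D.Ver // w ≠ v} → HalfEdge D.Leg D.Ver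
    | leg x => legι x
    | inn w => inn w.1
    | out w c => out w.1 c
  have hιc : ∀ w j, ι (corner w j) = corner w.1 j := by
    intro w j; fin_cases j <;> rfl
  have hlegι : ∀ x, legι x = corner v (k + 2) ∧ x = none ∨
      legι x = corner v (k + 1) ∧ x = some s ∨ ∃ y, y ≠ s ∧ legι x = leg y ∧ x = some y := by
    rintro (_ | x)
    · exact Or.inl ⟨rfl, rfl⟩
    · by_cases hx : x = s
      · exact Or.inr (Or.inl ⟨if_pos hx, by rw [hx]⟩)
      · exact Or.inr (Or.inr ⟨x, hx, if_neg hx, rfl⟩)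
  have hlc : ∀ x (w : {w : D.Ver // w ≠ v}) j, legι x ≠ corner w.1 j := by
    intro x w j h
    rcases hlegι x with ⟨h1, _⟩ | ⟨h1, _⟩ | ⟨y, _, h1, _⟩ <;> rw [h1] at h
    · exact w.2 (corner_inj h).1.symm
    · exact w.2 (corner_inj h).1.symm
    · exact corner_ne_leg _ _ _ h.symm
  have hinj : Function.Injective ι := by
    intro h h' e
    rcases eq_leg_or_eq_corner h with ⟨x, rfl⟩ | ⟨w, j, rfl⟩ <;>
      rcases eq_leg_or_eq_corner h' with ⟨x', rfl⟩ | ⟨w', j', rfl⟩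
    · change legι x = legι x' at e
      rcases hlegι x with ⟨h1, rfl⟩ | ⟨h1, rfl⟩ | ⟨y, _, h1, rfl⟩ <;>
        rcases hlegι x' with ⟨h2, rfl⟩ | ⟨h2, rfl⟩ | ⟨y', _, h2, rfl⟩ <;>
        first
        | rfl
        | (exfalso; rw [h1, h2] at e
           first
           | exact hk3 (corner_inj e).2
           | exact hk3 (corner_inj e).2.symm
           | exact corner_ne_leg _ _ _ e
           | exact corner_ne_leg _ _ _ e.symm)
        | (rw [h1, h2] at e; cases e; rfl)
    · rw [hιc] at e; exact absurd e (hlc _ _ _)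
    · rw [hιc] at e; exact absurd e.symm (hlc _ _ _)
    · rw [hιc, hιc] at e
      obtain ⟨e1, rfl⟩ := corner_inj e
      rw [Subtype.ext e1]
  -- The only half-edges of `D` that are lost are the two ends of the edge from `s` to `v`.
  have hrange : ∀ h, h ≠ leg s → h ≠ corner v k → ∃ h', ι h' = h := by
    intro h h1 h2
    rcases eq_leg_or_eq_corner h with ⟨x, rfl⟩ | ⟨w, j, rfl⟩
    · exact ⟨leg (some x), if_neg fun hx => h1 (by rw [hx])⟩
    · by_cases hw : w = v
      · subst hw
        rcases hk j with rfl | rfl | rfl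
        · exact absurd rfl h2
        · exact ⟨leg (some s), if_pos rfl⟩
        · exact ⟨leg none, rfl⟩
      · exact ⟨corner ⟨w, hw⟩ j, hιc _ _⟩
  have hlost : ∀ h, ι h ≠ leg s ∧ ι h ≠ corner v k := by
    intro h
    rcases eq_leg_or_eq_corner h with ⟨x, rfl⟩ | ⟨w, j, rfl⟩
    · change legι x ≠ _ ∧ legι x ≠ _
      rcases hlegι x with ⟨h1, _⟩ | ⟨h1, _⟩ | ⟨y, hy, h1, _⟩ <;> rw [h1]
      · exact ⟨corner_ne_leg _ _ _, fun h => hk2 (corner_inj h).2⟩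
      · exact ⟨corner_ne_leg _ _ _, fun h => hk1 (corner_inj h).2⟩
      · exact ⟨fun h => by cases h; exact hy rfl, (corner_ne_leg _ _ _).symm⟩
    · rw [hιc]
      exact ⟨corner_ne_leg _ _ _, fun h => w.2 (corner_inj h).1⟩
  have hin : ∀ h, D.isHead (ι h) = HalfEdge.isHead (fun x => D.isHead (legι x)) h := by
    rintro (x | w | ⟨w, c⟩) <;> rfl
  obtain ⟨opp, h1, h2, h3⟩ := exists_opp (fun x => D.isHead (legι x)) ι hinj D.opp D.opp_opp
    D.isHead D.isHead_opp hin (fun h => hrange _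
      (fun e => (hlost h).2 (by rw [← D.opp_opp (ι h), e, hs]))
      (fun e => (hlost h).1 (by rw [← D.opp_opp (ι h), e, hv])))
  let S : DirectedDiagram :=
    { Leg := Option D.Leg
      Ver := {w : D.Ver // w ≠ v}
      finite_ver := inferInstance
      circle := ((none :: some s :: l.map some : List (Option D.Leg)) : Cycle (Option D.Leg))
      nodup := by
        have := hnd.map (Option.some_injective D.Leg)
        rw [Cycle.nodup_coe_iff, List.nodup_cons]
        exact ⟨by simp, this⟩
      mem_circle := by
        rintro (_ | x)
        · simp
        · have := hmem x
          simp only [Cycle.mem_coe_iff, List.mem_cons] at this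
          simpa using this
      inward := fun x => D.isHead (legι x)
      opp := opp
      opp_opp := h1
      opp_head := h2 }
  have hb : legι (some s) = corner v (k + 1) := if_pos rfl
  refine ⟨S, none, some s, l.map some, ⟨rfl, s, v, k, fun x => x.getD s, Subtype.val, ι, ?_,
    Subtype.val_injective, ?_, hs, hb, rfl, ?_, fun _ => rfl, fun _ _ => rfl,
    fun h => (h3 h).symm, hin⟩, ?_, ?_, ?_, ι, hinj, fun h => (h3 h).symm, hb, rfl, ?_⟩
  · rw [hl, List.map_map]
    simp [Function.comp_def]
  · ext w; exact ⟨fun ⟨y, hy⟩ => hy ▸ y.2, fun h => ⟨⟨w, h⟩, rfl⟩⟩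
  · intro x hx
    obtain ⟨y, hy, rfl⟩ := List.mem_map.1 hx
    exact if_neg fun (h : y = s) => (List.nodup_cons.1 hnd).1 (h ▸ hy)
  · exact Finite.card_option
  · exact D.isHead_corner v _
  · change D.isHead (legι (some s)) = _
    rw [hb]
    exact D.isHead_corner v _
  · intro x hx1 hx2
    rcases hlegι x with ⟨h, _⟩ | ⟨h, _⟩ | ⟨y, _, h, _⟩
    · exact absurd h hx2
    · exact absurd h hx1
    · exact ⟨y, h⟩

/-! ### Diagrams with internal vertices vanish -/

theorem IsResolution.card_leg {U S : DirectedDiagram} {a b : S.Leg} {l : List S.Leg}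
    (h : IsResolution U S a b l) : Nat.card S.Leg = Nat.card U.Leg + 1 := by
  obtain ⟨hc, s, v, k, f, g, ι, hU, -⟩ := h
  rw [S.card_leg hc, U.card_leg hU]
  simp

theorem IsResolution.nonempty_ver {U S : DirectedDiagram} {a b : S.Leg} {l : List S.Leg}
    (h : IsResolution U S a b l) : Nonempty U.Ver := by
  obtain ⟨hc, s, v, -⟩ := h
  exact ⟨v⟩

theorem exchangeable_of_inward {D : DirectedDiagram} {a b : D.Leg} (ha : D.inward a = true)
    (hb : D.inward b = true) : D.Exchangeable a b := by
  intro l h h'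
  exact (cls_swapLegs_of_inward (S := D.recircle _ h) rfl ha hb).trans
    (congrArg cls ((D.recircle _ h).swapLegs_eq_recircle rfl h'))

/-- Neighbouring external vertices may be exchanged as soon as the correction terms of the STU
relation vanish. -/
theorem exchangeable_of_resolution {D : DirectedDiagram} {a b : D.Leg}
    (hU : ∀ l h U, IsResolution U (D.recircle (a :: b :: l) h) a b l → U.cls = 0) :
    D.Exchangeable a b := by
  by_cases hab : D.inward a = true ∧ D.inward b = true
  · exact exchangeable_of_inward hab.1 hab.2
  · intro l h h'
    obtain ⟨U, hR⟩ := exists_resolution (D.recircle _ h) a b l rfl hab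
    have := cls_sub_cls_swapLegs hR
    rw [hU l h U hR, sub_eq_zero] at this
    rw [this, (D.recircle _ h).swapLegs_eq_recircle rfl h']
    rfl

/-- If an involution `o` pairs `p` with `P` and `q` with `Q`, then conjugating it by `swap p q` has the
same effect as conjugating it by `swap P Q`. -/
theorem conj_swap_eq {T : Type} [DecidableEq T] (o : T → T) (ho : ∀ t, o (o t) = t) {p q P Q : T}
    (h1 : o p = P) (h2 : o q = Q) (hpP : p ≠ P) (hpQ : p ≠ Q) (hqP : q ≠ P) (hqQ : q ≠ Q) (t : T) :
    Equiv.swap p q (o (Equiv.swap p q (Equiv.swap P Q t))) = Equiv.swap P Q (o t) := by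
  have h3 : o P = p := by rw [← h1, ho]
  have h4 : o Q = q := by rw [← h2, ho]
  simp only [Equiv.swap_apply_def]
  grind

/-- A diagram with an internal vertex both of whose outgoing edges end on the circle vanishes if
external vertices may be exchanged freely: exchanging the two ends has the same effect as reversing
the orientation of the vertex. -/
theorem cls_eq_zero_of_cherry (D : DirectedDiagram) (v : D.Ver) (x y : D.Leg)
    (hx : D.opp (out v false) = leg x) (hy : D.opp (out v true) = leg y)
    (hE : ∀ a b, (D.flip v).Exchangeable a b) : D.cls = 0 := by
  classical
  obtain ⟨l, hl, harr⟩ := D.exists_circle_eq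
  have hp : (l.map (Equiv.swap x y)).Perm l := by
    refine (List.perm_ext_iff_of_nodup (harr.1.map (Equiv.injective _)) harr.1).2 fun z => ?_
    exact ⟨fun _ => harr.2 z, fun _ =>
      List.mem_map.2 ⟨Equiv.swap x y z, harr.2 _, Equiv.swap_apply_self x y z⟩⟩
  have harr' := perm_arrangement hp.symm harr
  have hin : D.inward x = D.inward y := by
    have h1 := D.isHead_opp (out v false)
    have h2 := D.isHead_opp (out v true)
    rw [hx] at h1
    rw [hy] at h2
    exact h1.trans h2.symm
  have hin' : ∀ z, D.inward (Equiv.swap x y z) = D.inward z := by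
    intro z
    rw [Equiv.swap_apply_def]
    split_ifs with h1 h2
    · rw [h1, hin]
    · rw [h2, hin]
    · rfl
  have hiso : D.Iso ((D.flip v).recircle (l.map (Equiv.swap x y)) harr') := by
    refine ⟨Equiv.swap x y, Equiv.refl _, ?_, hin', ?_⟩
    · rw [hl]; rfl
    · have hmap : ∀ h : HalfEdge D.Leg D.Ver, HalfEdge.map (Equiv.swap x y) (Equiv.refl D.Ver) h =
          Equiv.swap (leg x) (leg y) h := by
        rintro (z | w | ⟨w, c⟩)
        · simp only [HalfEdge.map, Equiv.swap_apply_def, leg.injEq]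
          split_ifs <;> rfl
        · exact (Equiv.swap_apply_of_ne_of_ne (a := leg x) (b := leg y) (x := inn w) (by simp)
            (by simp)).symm
        · exact (Equiv.swap_apply_of_ne_of_ne (a := leg x) (b := leg y) (x := out w c) (by simp)
            (by simp)).symm
      intro h
      refine Eq.trans ?_ (hmap _).symm
      refine Eq.trans ?_ (conj_swap_eq D.opp D.opp_opp hx hy (by simp) (by simp) (by simp)
        (by simp) h)
      rw [← hmap]
      change Equiv.swap _ _ (D.opp ((Equiv.swap _ _).symm _)) = _
      rw [Equiv.symm_swap]
      congr!
  have h1 : D.cls = -D.cls :=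
    (cls_eq_of_iso hiso).trans <| (cls_recircle_eq_of_perm _ hE hp harr' harr).trans <|
      (congrArg cls (recircle_self (D.flip v) harr hl)).trans (D.cls_flip v)
  have h2 : (2 : ℂ) • D.cls = 0 := by
    rw [two_smul]
    exact eq_neg_iff_add_eq_zero.1 h1
  exact (smul_eq_zero.1 h2).resolve_left two_ne_zero

theorem exists_eq_inn_of_isHead (D : DirectedDiagram) {h : HalfEdge D.Leg D.Ver}
    (hh : D.isHead h = true) (hl : ∀ x, h ≠ leg x) : ∃ w, h = inn w := by
  rcases h with x | w | ⟨w, c⟩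
  · exact absurd rfl (hl x)
  · exact ⟨w, rfl⟩
  · cases hh

/-- If no internal vertex has both outgoing edges ending on the circle, then no edge leads from
the circle to an internal vertex, and every internal vertex has exactly one outgoing edge ending on
the circle.  Indeed, choosing at each vertex an outgoing edge that ends at a vertex gives an
injective, hence bijective, self-map of the finite set of internal vertices. -/
theorem wheels_of_no_cherry (D : DirectedDiagram)
    (hno : ∀ v, ∃ c, ∀ x, D.opp (out v c) ≠ leg x) :
    (∀ x w, D.opp (leg x) ≠ inn w) ∧
      ∀ v, ∃ c x w, D.opp (out v c) = leg x ∧ D.opp (out v (!c)) = inn w := by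
  have := D.finite_ver
  choose c hc using hno
  have h1 : ∀ v, ∃ w, D.opp (out v (c v)) = inn w := fun v =>
    D.exists_eq_inn_of_isHead (by rw [D.isHead_opp]; rfl) (hc v)
  choose φ hφ using h1
  have hinj : Function.Injective φ := by
    intro v v' h
    have h2 : D.opp (out v (c v)) = D.opp (out v' (c v')) := by rw [hφ, hφ, h]
    have h3 := D.opp_injective h2
    rw [out.injEq] at h3
    exact h3.1
  have hsurj : Function.Surjective φ := Finite.surjective_of_injective hinj
  have hback : ∀ w h, D.opp h = inn w → ∃ v, h = out v (c v) := by
    intro w h hh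
    obtain ⟨v, rfl⟩ := hsurj w
    exact ⟨v, D.opp_injective (hh.trans (hφ v).symm)⟩
  constructor
  · intro x w h
    obtain ⟨v, hv⟩ := hback w _ h
    cases hv
  · intro v
    refine ⟨!c v, ?_⟩
    have hx : ∃ x, D.opp (out v (!c v)) = leg x := by
      by_contra hx
      push Not at hx
      obtain ⟨w, hw⟩ := D.exists_eq_inn_of_isHead (by rw [D.isHead_opp]; rfl) hx
      obtain ⟨u, hu⟩ := hback w _ hw
      rw [out.injEq] at hu
      obtain ⟨rfl, h⟩ := hu
      exact Bool.not_ne_self _ h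
    obtain ⟨x, hx⟩ := hx
    exact ⟨x, φ v, hx, by rw [Bool.not_not]; exact hφ v⟩

/-- A resolution inherits from `S` an edge leading from the circle to an internal vertex; the edge
from `p` to the external vertex `q` that is resolved becomes such an edge, too. -/
theorem IsResolution.exists_leg_inn {U S : DirectedDiagram} {q y : S.Leg} {l : List S.Leg}
    (h : IsResolution U S q y l) {p : S.Leg} (hpq : p ≠ q) (hpy : p ≠ y)
    (hp : S.opp (leg p) = leg q ∧ S.inward q = true ∨ ∃ w, S.opp (leg p) = inn w) :
    ∃ x w, U.opp (leg x) = inn w := by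
  obtain ⟨hc, s, v, k, f, g, ι, -, -, -, -, -, hq, hl, hinn, -, hopp, hhead⟩ := h
  have hpl : p ∈ l := by
    have := S.mem_circle p
    rw [hc, Cycle.mem_coe_iff] at this
    simpa [hpq, hpy] using this
  refine ⟨f p, ?_⟩
  rw [← hl p hpl, hopp]
  rcases hp with ⟨hp, hin⟩ | ⟨w, hp⟩
  · rw [hp]
    refine U.exists_eq_inn_of_isHead ((hhead _).trans hin) fun x hx => ?_
    rw [hq] at hx
    exact corner_ne_leg _ _ _ hx
  · rw [hp]
    exact ⟨g w, hinn w⟩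

/-- The class of every diagram with an internal vertex is zero. -/
theorem cls_eq_zero_of_nonempty_ver (D : DirectedDiagram) (hD : Nonempty D.Ver) : D.cls = 0 := by
  induction hn : Nat.card D.Leg using Nat.strong_induction_on generalizing D with
  | h n ih =>
  have hex : ∀ E : DirectedDiagram, Nat.card E.Leg = n → ∀ a b, E.Exchangeable a b := by
    intro E hE a b
    refine exchangeable_of_resolution fun l h U hU => ih _ ?_ U hU.nonempty_ver rfl
    have : Nat.card E.Leg = _ := hU.card_leg
    omega
  have hcherry : ∀ E : DirectedDiagram, Nat.card E.Leg = n →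
      ∀ v, (∀ c, ∃ x, E.opp (out v c) = leg x) → E.cls = 0 := by
    intro E hE v hv
    obtain ⟨x, hx⟩ := hv false
    obtain ⟨y, hy⟩ := hv true
    exact E.cls_eq_zero_of_cherry v x y hx hy (hex _ hE)
  have hroot : ∀ E : DirectedDiagram, Nat.card E.Leg = n →
      (∃ x w, E.opp (leg x) = inn w) → E.cls = 0 := by
    rintro E hE ⟨x, w, hxw⟩
    by_contra h0
    refine (E.wheels_of_no_cherry fun v => ?_).1 x w hxw
    by_contra hv
    push Not at hv
    exact h0 (hcherry E hE v hv)
  by_contra h0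
  obtain ⟨hno, hwheel⟩ := D.wheels_of_no_cherry fun v => by
    by_contra hv
    push Not at hv
    exact h0 (hcherry D hn v hv)
  obtain ⟨v⟩ := hD
  obtain ⟨c, s, w, hs, hw⟩ := hwheel v
  have hs' : D.opp (leg s) = out v c := by rw [← hs, D.opp_opp]
  -- `D` is a wheel through `v` with a spoke ending at `s`; cut it open at `v`.
  obtain ⟨k, hk⟩ : ∃ k : Fin 3, D.opp (leg s) = corner v k ∧
      (c = false ∧ k = 1 ∨ c = true ∧ k = 2) := by
    cases c
    · exact ⟨1, hs', Or.inl ⟨rfl, rfl⟩⟩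
    · exact ⟨2, hs', Or.inr ⟨rfl, rfl⟩⟩
  obtain ⟨S, a, b, l, hR, hcard, ha, hb, ι, hι, hιo, hιb, hιa, hιl⟩ := D.exists_cut s v k hk.1
  -- The path obtained from the wheel leads from `p` to `q`; all corrections that arise when `q`
  -- passes another external vertex still have the edge starting at `p`.
  have key : ∀ p q : S.Leg, p ≠ q → S.inward p = false → S.inward q = true →
      ι (leg q) = inn v → ι (leg p) = out v (!c) →
      (∀ x, ι (leg x) ≠ inn v → ι (leg x) ≠ out v (!c) → ∃ y, ι (leg x) = leg y) →
      ∀ y, y ≠ p → S.Exchangeable q y := by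
    intro p q hpq hp hq hιq hιp hιx y hy
    refine exchangeable_of_resolution fun m h U hU => hroot U ?_ ?_
    · have : Nat.card S.Leg = _ := hU.card_leg
      omega
    · refine hU.exists_leg_inn hpq hy.symm ?_
      change S.opp (leg p) = leg q ∧ S.inward q = true ∨ ∃ w, S.opp (leg p) = inn w
      by_cases hx : ∃ x, S.opp (leg p) = leg x
      · obtain ⟨x, hx⟩ := hx
        have h1 : ι (leg x) = inn w := by rw [← hx, ← hιo, hιp, hw]
        left
        rw [hx]
        refine ⟨?_, hq⟩
        by_contra hxq
        obtain ⟨z, hz⟩ := hιx x (fun e => hxq (hι (e.trans hιq.symm)))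
          (fun e => by rw [h1] at e; cases e)
        rw [h1] at hz
        cases hz
      · push Not at hx
        refine Or.inr (S.exists_eq_inn_of_isHead ?_ hx)
        rw [S.isHead_opp]
        change (!S.inward p) = true
        rw [hp, Bool.not_false]
  have harr : (a :: b :: l).Nodup ∧ ∀ x, x ∈ a :: b :: l := by
    have hn := S.nodup
    have hm := S.mem_circle
    rw [hR.1] at hn hm
    exact ⟨hn, hm⟩
  have hab : a ≠ b := fun e => (List.nodup_cons.1 harr.1).1 (by simp [e])
  have harr' := perm_arrangement (List.Perm.swap b a l) harr
  have hST := cls_sub_cls_swapLegs hR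
  rw [S.swapLegs_eq_recircle hR.1 harr'] at hST
  refine h0 (hST.symm.trans (sub_eq_zero.2 ?_))
  rw [← congrArg cls (S.recircle_self harr hR.1)]
  rcases hk.2 with ⟨rfl, rfl⟩ | ⟨rfl, rfl⟩
  · exact (S.cls_recircle_around b a (key b a hab.symm hb ha hιa hιb
      fun x h1 h2 => hιl x h2 h1) l harr' harr).symm
  · exact S.cls_recircle_around a b (key a b hab ha hb hιb hιa
      fun x h1 h2 => hιl x h1 h2) l harr harr'

/-! ### Chord diagrams -/

/-- The number of external vertices at heads of arrows; it is the degree of a diagram without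
internal vertices. -/
noncomputable def numInward (D : DirectedDiagram) : ℕ := Nat.card {x // D.inward x = true}

theorem degree_eq_numInward (D : DirectedDiagram) (hD : IsEmpty D.Ver) :
    D.degree = D.numInward := by
  have h1 : Nat.card {h : HalfEdge D.Leg D.Ver // D.isHead h = true} = D.numInward := by
    refine (Nat.card_congr (Equiv.ofBijective
      (fun x : {x // D.inward x = true} => ⟨leg x.1, x.2⟩) ⟨fun x y h => ?_, ?_⟩)).symm
    · have := congrArg Subtype.val h
      exact Subtype.ext (leg.inj this)
    · rintro ⟨x | v | ⟨v, c⟩, h⟩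
      · exact ⟨⟨x, h⟩, rfl⟩
      · exact hD.elim v
      · exact hD.elim v
  rw [degree, h1, Nat.card_of_isEmpty]
  simp

/-- In a diagram without internal vertices every external vertex has a partner, the other end of its
chord. -/
theorem exists_partner (D : DirectedDiagram) (hD : IsEmpty D.Ver) :
    ∃ π : D.Leg → D.Leg, (∀ x, D.opp (leg x) = leg (π x)) ∧ (∀ x, π (π x) = x) ∧
      ∀ x, D.inward (π x) = !D.inward x := by
  have h : ∀ x, ∃ y, D.opp (leg x) = leg y := by
    intro x
    rcases D.opp (leg x) with y | v | ⟨v, c⟩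
    · exact ⟨y, rfl⟩
    · exact hD.elim v
    · exact hD.elim v
  choose π hπ using h
  refine ⟨π, hπ, fun x => ?_, fun x => ?_⟩
  · have := D.opp_opp (leg x)
    rw [hπ, hπ] at this
    exact leg.inj this
  · have := D.isHead_opp (leg x)
    rw [hπ] at this
    exact this

/-- A diagram of `n` chords without internal vertices: chord `i` leads from `(i, false)` to
`(i, true)`, and the ends lie on the circle in an unspecified order. -/
noncomputable def chords (n : ℕ) : DirectedDiagram where
  Leg := Fin n × Bool
  Ver := Empty
  finite_ver := inferInstance
  circle := ((Finset.univ.toList : List (Fin n × Bool)) : Cycle (Fin n × Bool))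
  nodup := Cycle.nodup_coe_iff.2 (Finset.nodup_toList _)
  mem_circle := fun x => by simp
  inward := Prod.snd
  opp := fun h => match h with
    | .leg x => .leg (x.1, !x.2)
    | .inn v => v.elim
    | .out v _ => v.elim
  opp_opp := fun h => by
    rcases h with x | v | ⟨v, c⟩
    · simp
    · exact v.elim
    · exact v.elim
  opp_head := fun h => by
    rcases h with x | v | ⟨v, c⟩
    · rfl
    · exact v.elim
    · exact v.elim

/-- All diagrams with the same number of chords and no internal vertices have the same class, since
the corrections in the STU relation have internal vertices. -/
theorem cls_eq_cls_chords (D : DirectedDiagram) (hD : IsEmpty D.Ver) :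
    D.cls = (chords D.numInward).cls := by
  have := D.finite_leg
  obtain ⟨π, hπ, hππ, hπin⟩ := D.exists_partner hD
  let e : Fin D.numInward ≃ {x // D.inward x = true} := (Finite.equivFin _).symm
  let g₀ : Fin D.numInward × Bool → D.Leg := fun p => if p.2 = true then (e p.1).1 else π (e p.1).1
  have hgt : ∀ i, g₀ (i, true) = (e i).1 := fun i => rfl
  have hgf : ∀ i, g₀ (i, false) = π (e i).1 := fun i => rfl
  have hgin : ∀ p, D.inward (g₀ p) = p.2 := by
    rintro ⟨i, _ | _⟩
    · rw [hgf, hπin, (e i).2]; rfl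
    · rw [hgt, (e i).2]
  have hgπ : ∀ i c, π (g₀ (i, c)) = g₀ (i, !c) := by
    rintro i (_ | _)
    · rw [hgf, hππ]; rfl
    · rfl
  have hg : Function.Bijective g₀ := by
    constructor
    · rintro ⟨i, c⟩ ⟨j, d⟩ h
      obtain rfl : c = d := by
        have := congrArg D.inward h
        rwa [hgin, hgin] at this
      have h1 : g₀ (i, true) = g₀ (j, true) := by
        cases c
        · have := congrArg π h
          rwa [hgπ, hgπ] at this
        · exact h
      obtain rfl : i = j := e.injective (Subtype.ext h1)
      rfl
    · intro x
      cases hx : D.inward x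
      · refine ⟨(e.symm ⟨π x, by rw [hπin, hx]; rfl⟩, false), ?_⟩
        rw [hgf, Equiv.apply_symm_apply, hππ]
      · exact ⟨(e.symm ⟨x, hx⟩, true), by rw [hgt, Equiv.apply_symm_apply]⟩
  let g := Equiv.ofBijective g₀ hg
  obtain ⟨l, hl, harr⟩ := D.exists_circle_eq
  have hall : ∀ p, p ∈ l.map g.symm := fun p =>
    List.mem_map.2 ⟨g p, harr.2 _, g.symm_apply_apply p⟩
  have hnd : (l.map g.symm).Nodup := harr.1.map g.symm.injective
  have harr0 : (Finset.univ.toList : List (Fin D.numInward × Bool)).Nodup ∧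
      ∀ p, p ∈ (Finset.univ.toList : List (Fin D.numInward × Bool)) :=
    ⟨Finset.nodup_toList _, fun p => by simp⟩
  have hiso : ((chords D.numInward).recircle (l.map g.symm) ⟨hnd, hall⟩).Iso D := by
    refine ⟨g, Equiv.equivOfIsEmpty Empty D.Ver, ?_, hgin, ?_⟩
    · rw [hl]
      change ((List.map g (l.map g.symm) : List D.Leg) : Cycle D.Leg) = l
      simp
    · rintro (⟨i, c⟩ | v | ⟨v, c⟩)
      · exact (hπ _).trans (congrArg leg (hgπ i c))
      · exact v.elim
      · exact v.elim
  have hex : ∀ a b, (chords D.numInward).Exchangeable a b := fun a b =>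
    exchangeable_of_resolution fun _ _ U hU => U.cls_eq_zero_of_nonempty_ver hU.nonempty_ver
  exact (cls_eq_of_iso hiso).symm.trans <|
    (cls_recircle_eq_of_perm _ hex ((List.perm_ext_iff_of_nodup hnd harr0.1).2
      fun p => ⟨fun _ => harr0.2 p, fun _ => hall p⟩) _ harr0).trans
      (congrArg cls (recircle_self _ harr0 rfl))

theorem numInward_chords (n : ℕ) : (chords n).numInward = n := by
  have : Nat.card {x : Fin n × Bool // x.2 = true} = n := by
    let f : Fin n → {x : Fin n × Bool // x.2 = true} := fun i => ⟨(i, true), rfl⟩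
    have hf : Function.Bijective f := by
      refine ⟨fun i j h => congrArg (fun x => x.1.1) h, ?_⟩
      rintro ⟨⟨i, c⟩, rfl : c = true⟩
      exact ⟨i, rfl⟩
    rw [← Nat.card_congr (Equiv.ofBijective f hf), Nat.card_fin]
  exact this

theorem numInward_theta : theta.numInward = 1 := by
  have : Nat.card {x : Bool // x = true} = 1 := by simp
  exact this

theorem Iso.numInward_eq {D E : DirectedDiagram} (h : D.Iso E) : D.numInward = E.numInward := by
  obtain ⟨f, -, -, hin, -⟩ := h
  exact Nat.card_congr (f.subtypeEquiv fun x => by rw [hin])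

theorem Iso.isEmpty_ver_iff {D E : DirectedDiagram} (h : D.Iso E) :
    IsEmpty D.Ver ↔ IsEmpty E.Ver := by
  obtain ⟨-, g, -⟩ := h
  exact g.isEmpty_congr

/-! ### Primitive diagrams -/

theorem isPrimitive_theta : theta.IsPrimitive := by
  have : Nonempty (theta.Leg ⊕ theta.Ver) := ⟨Sum.inl true⟩
  refine SimpleGraph.Connected.mk fun p q => ?_
  rcases p with (x : Bool) | v
  · rcases q with (y : Bool) | w
    · by_cases h : x = y
      · rw [h]
      · refine SimpleGraph.Adj.reachable ?_
        rw [graph, SimpleGraph.fromRel_adj]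
        refine ⟨fun e => h (Sum.inl.inj e), Or.inl ⟨leg x, rfl, ?_⟩⟩
        change (Sum.inl (!x) : Bool ⊕ Empty) = Sum.inl y
        rw [Bool.eq_not.2 (Ne.symm h)]
    · exact Empty.elim w
  · exact Empty.elim v

theorem degree_theta : theta.degree = 1 := by
  rw [degree_eq_numInward theta (inferInstanceAs (IsEmpty Empty)), numInward_theta]
  rfl

/-- A primitive diagram without internal vertices is a single chord. -/
theorem IsPrimitive.iso_theta {D : DirectedDiagram} (hD : D.IsPrimitive) (hV : IsEmpty D.Ver) :
    D.Iso theta := by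
  obtain ⟨π, hπ, hππ, hπin⟩ := D.exists_partner hV
  obtain ⟨x⟩ : Nonempty D.Leg := by
    obtain ⟨x | v⟩ := hD.nonempty
    · exact ⟨x⟩
    · exact hV.elim v
  have hadj : ∀ p q, D.graph.Adj p q → ∃ z, p = Sum.inl z ∧ q = Sum.inl (π z) := by
    intro p q h
    rw [graph, SimpleGraph.fromRel_adj] at h
    obtain ⟨-, ⟨z | v | ⟨v, c⟩, rfl, rfl⟩ | ⟨z | v | ⟨v, c⟩, rfl, rfl⟩⟩ := h
    · exact ⟨z, rfl, by rw [hπ]; rfl⟩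
    · exact hV.elim v
    · exact hV.elim v
    · exact ⟨π z, by rw [hπ]; rfl, by rw [hππ]; rfl⟩
    · exact hV.elim v
    · exact hV.elim v
  have hwalk : ∀ p q, D.graph.Walk p q → p = Sum.inl x ∨ p = Sum.inl (π x) →
      q = Sum.inl x ∨ q = Sum.inl (π x) := by
    intro p q w
    induction w with
    | nil => exact id
    | cons h _ ih =>
      intro hp
      obtain ⟨z, rfl, rfl⟩ := hadj _ _ h
      refine ih ?_
      rcases hp with h | h
      · rw [Sum.inl.inj h]; exact Or.inr rfl
      · rw [Sum.inl.inj h, hππ]; exact Or.inl rfl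
  have hlegs : ∀ z, z = x ∨ z = π x := by
    intro z
    obtain ⟨w⟩ := hD.preconnected (Sum.inl x) (Sum.inl z)
    exact (hwalk _ _ w (Or.inl rfl)).imp Sum.inl.inj Sum.inl.inj
  have hne : D.inward (π x) ≠ D.inward x := by rw [hπin]; exact Bool.not_ne_self _
  have hbij : Function.Bijective D.inward := by
    constructor
    · intro z z' h
      rcases hlegs z with rfl | rfl <;> rcases hlegs z' with rfl | rfl
      · rfl
      · exact absurd h.symm hne
      · exact absurd h hne
      · rfl
    · intro c
      by_cases hc : D.inward x = c
      · exact ⟨x, hc⟩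
      · exact ⟨π x, by rw [hπin]; exact Bool.not_eq.2 hc⟩
  refine ⟨Equiv.ofBijective D.inward hbij, Equiv.equivOfIsEmpty D.Ver Empty, ?_, fun _ => rfl, ?_⟩
  · obtain ⟨l, hl, hnd, hmem⟩ := D.exists_circle_eq
    have hnd' := hnd.map hbij.1
    have hmem' : ∀ c, c ∈ l.map D.inward := fun c => by
      obtain ⟨z, rfl⟩ := hbij.2 c
      exact List.mem_map_of_mem (hmem z)
    rw [hl]
    change ((l.map D.inward : List Bool) : Cycle Bool) = (([false, true] : List Bool) : Cycle Bool)
    generalize l.map D.inward = m at hnd' hmem'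
    have hlen := hnd'.length_le_card
    have h0 := hmem' false
    have h1 := hmem' true
    rcases m with _ | ⟨a, _ | ⟨b, _ | ⟨c, t⟩⟩⟩
    · simp at h0
    · cases a <;> simp at h0 h1
    · cases a <;> cases b <;> simp at h0 h1
      · rfl
      · exact Cycle.coe_eq_coe.2 ⟨1, rfl⟩
    · simp at hlen
  · rintro (z | v | ⟨v, c⟩)
    · rw [hπ]
      exact congrArg leg (hπin z).symm
    · exact hV.elim v
    · exact hV.elim v

/-! ### The connected sum product -/

open Polynomial

open Classical in
/-- The monomial `X ^ n` for a diagram of `n` chords without internal vertices, zero for a diagram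
with internal vertices. -/
noncomputable def weight (D : DirectedDiagram) : ℂ[X] :=
  if IsEmpty D.Ver then X ^ D.numInward else 0

theorem weight_of_isEmpty {D : DirectedDiagram} (h : IsEmpty D.Ver) :
    D.weight = X ^ D.numInward := if_pos h

theorem weight_of_nonempty {D : DirectedDiagram} (h : Nonempty D.Ver) : D.weight = 0 :=
  if_neg (not_isEmpty_iff.2 h)

theorem Iso.weight_eq {D E : DirectedDiagram} (h : D.Iso E) : D.weight = E.weight := by
  by_cases hD : IsEmpty D.Ver
  · rw [weight_of_isEmpty hD, weight_of_isEmpty (h.isEmpty_ver_iff.1 hD), h.numInward_eq]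
  · rw [weight_of_nonempty (not_isEmpty_iff.1 hD),
      weight_of_nonempty (not_isEmpty_iff.1 (h.isEmpty_ver_iff.not.1 hD))]

theorem linearCombination_weight_relation {r : DirectedDiagram →₀ ℂ} (h : Relation r) :
    Finsupp.linearCombination ℂ weight r = 0 := by
  have hgen : ∀ D, Finsupp.linearCombination ℂ weight (gen D) = D.weight := fun D => by
    simp [gen]
  have hswap : ∀ (S : DirectedDiagram) a b, (S.swapLegs a b).weight = S.weight := fun _ _ _ => rfl
  cases h with
  | iso D E h => rw [map_sub, hgen, hgen, h.weight_eq, sub_self]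
  | antisymmetry D v =>
    rw [map_add, hgen, hgen, weight_of_nonempty ⟨v⟩, weight_of_nonempty (D := D.flip v) ⟨v⟩,
      add_zero]
  | ihx D v w c hvw h =>
    rw [map_add, map_add, hgen, hgen, hgen, weight_of_nonempty ⟨v⟩,
      weight_of_nonempty (D := D.ihxSecond v w c) ⟨v⟩,
      weight_of_nonempty (D := D.ihxThird v w c) ⟨v⟩, add_zero, add_zero]
  | stu U S a b l h =>
    rw [map_sub, map_sub, hgen, hgen, hgen, hswap, weight_of_nonempty h.nonempty_ver, sub_self,
      sub_zero]
  | stuInward S a b l h ha hb => rw [map_sub, hgen, hgen, hswap, sub_self]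

/-- The linear extension of `weight` to the algebra of directed diagrams. -/
noncomputable def toPolynomial : DirectedAlgebra →ₗ[ℂ] ℂ[X] :=
  Submodule.liftQ _ (Finsupp.linearCombination ℂ weight) <|
    Submodule.span_le.2 fun _ h => linearCombination_weight_relation h

theorem toPolynomial_cls (D : DirectedDiagram) : toPolynomial D.cls = D.weight := by
  rw [cls, toPolynomial, Submodule.liftQ_apply]
  simp [gen]

/-- The linear map sending `X ^ n` to the class of a diagram of `n` chords. -/
noncomputable def ofPolynomial : ℂ[X] →ₗ[ℂ] DirectedAlgebra :=
  (Polynomial.basisMonomials ℂ).constr ℂ fun n => (chords n).cls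

theorem ofPolynomial_X_pow (n : ℕ) : ofPolynomial (X ^ n) = (chords n).cls := by
  have := (Polynomial.basisMonomials ℂ).constr_basis ℂ (fun n => (chords n).cls) n
  rw [Polynomial.coe_basisMonomials] at this
  rw [Polynomial.X_pow_eq_monomial]
  exact this

/-- The product of polynomials, transported to the algebra of directed diagrams. -/
noncomputable def product : DirectedAlgebra →ₗ[ℂ] DirectedAlgebra →ₗ[ℂ] DirectedAlgebra :=
  ((LinearMap.mul ℂ ℂ[X]).compl₁₂ toPolynomial toPolynomial).compr₂ ofPolynomial

theorem product_cls (D E : DirectedDiagram) :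
    product D.cls E.cls = ofPolynomial (D.weight * E.weight) := by
  rw [← toPolynomial_cls, ← toPolynomial_cls]
  rfl

theorem isConnectedSumProduct_product : IsConnectedSumProduct product := by
  intro D E l m hl hm
  have := D.finite_leg
  have := E.finite_leg
  rw [product_cls]
  by_cases hD : IsEmpty D.Ver
  · by_cases hE : IsEmpty E.Ver
    · have hS : IsEmpty (connectedSum D E l m hl hm).Ver := inferInstanceAs (IsEmpty (_ ⊕ _))
      have hn : (connectedSum D E l m hl hm).numInward = D.numInward + E.numInward :=
        (Nat.card_congr Equiv.subtypeSum).trans Nat.card_sum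
      rw [weight_of_isEmpty hD, weight_of_isEmpty hE, ← pow_add, ofPolynomial_X_pow,
        cls_eq_cls_chords _ hS, hn]
    · obtain ⟨v⟩ := not_isEmpty_iff.1 hE
      rw [weight_of_nonempty ⟨v⟩, mul_zero, map_zero,
        cls_eq_zero_of_nonempty_ver _ ⟨(Sum.inr v : D.Ver ⊕ E.Ver)⟩]
  · obtain ⟨v⟩ := not_isEmpty_iff.1 hD
    rw [weight_of_nonempty ⟨v⟩, zero_mul, map_zero,
      cls_eq_zero_of_nonempty_ver _ ⟨(Sum.inl v : D.Ver ⊕ E.Ver)⟩]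

theorem thetaPow_product (n : ℕ) : thetaPow product n = (chords n).cls := by
  induction n with
  | zero =>
    have h : empty.numInward = 0 := by
      have : Nat.card {x : Empty // (x.elim : Bool) = true} = 0 := Nat.card_of_isEmpty
      exact this
    rw [thetaPow, cls_eq_cls_chords empty (inferInstanceAs (IsEmpty Empty)), h]
  | succ n ih =>
    rw [thetaPow, ih, product_cls, weight_of_isEmpty (inferInstanceAs (IsEmpty Empty)),
      weight_of_isEmpty (D := chords n) (inferInstanceAs (IsEmpty Empty)), numInward_theta,
      numInward_chords, ← pow_add, ofPolynomial_X_pow, add_comm]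

theorem cls_eq_zero_or_eq_thetaPow (n : ℕ) (D : DirectedDiagram) (hD : D.degree = (n : ℤ)) :
    D.cls = 0 ∨ D.cls = thetaPow product n := by
  by_cases hV : IsEmpty D.Ver
  · right
    rw [D.degree_eq_numInward hV, Nat.cast_inj] at hD
    rw [thetaPow_product, D.cls_eq_cls_chords hV, hD]
  · exact Or.inl (D.cls_eq_zero_of_nonempty_ver (not_isEmpty_iff.1 hV))

theorem IsPrimitive.cls_eq_zero_or_iso_theta {D : DirectedDiagram} (hD : D.IsPrimitive) :
    D.cls = 0 ∨ D.Iso theta := by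
  by_cases hV : IsEmpty D.Ver
  · exact Or.inr (hD.iso_theta hV)
  · exact Or.inl (D.cls_eq_zero_of_nonempty_ver (not_isEmpty_iff.1 hV))

theorem Iso.degree_eq_one {D : DirectedDiagram} (h : D.Iso theta) : D.degree = 1 := by
  rw [D.degree_eq_numInward (h.isEmpty_ver_iff.2 (inferInstanceAs (IsEmpty Empty))),
    h.numInward_eq, numInward_theta]
  rfl

end DirectedDiagram

theorem mainTheorem3 :
    (∀ D : DirectedDiagram, D.IsPrimitive → ¬ D.Iso DirectedDiagram.theta → D.cls = 0) ∧
    (∀ n : ℕ, n ≠ 1 → DirectedDiagram.primitivePart n = ⊥) ∧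
    DirectedDiagram.primitivePart 1 = Submodule.span ℂ {DirectedDiagram.theta.cls} ∧
    ∃ μ : DirectedAlgebra →ₗ[ℂ] DirectedAlgebra →ₗ[ℂ] DirectedAlgebra,
      DirectedDiagram.IsConnectedSumProduct μ ∧
      (∀ (n : ℕ) (D : DirectedDiagram), D.degree = (n : ℤ) →
        D.cls = 0 ∨ D.cls = DirectedDiagram.thetaPow μ n) ∧
      (∀ (n : ℕ), ∀ x ∈ DirectedDiagram.degreePart n,
        ∃ c : ℂ, x = c • DirectedDiagram.thetaPow μ n) := by
  refine ⟨fun D hD hne => hD.cls_eq_zero_or_iso_theta.resolve_right hne, fun n hn => ?_, ?_,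
    DirectedDiagram.product, DirectedDiagram.isConnectedSumProduct_product,
    DirectedDiagram.cls_eq_zero_or_eq_thetaPow, fun n x hx => ?_⟩
  · rw [DirectedDiagram.primitivePart, Submodule.span_eq_bot]
    rintro _ ⟨D, hD, hdeg, rfl⟩
    refine hD.cls_eq_zero_or_iso_theta.resolve_right fun hiso => hn ?_
    rw [hiso.degree_eq_one] at hdeg
    exact_mod_cast hdeg.symm
  · refine le_antisymm (Submodule.span_le.2 ?_) (Submodule.span_mono ?_)
    · rintro _ ⟨D, hD, -, rfl⟩
      rcases hD.cls_eq_zero_or_iso_theta with h | h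
      · rw [h]; exact Submodule.zero_mem _
      · rw [DirectedDiagram.cls_eq_of_iso h]; exact Submodule.mem_span_singleton_self _
    · rintro _ rfl
      exact ⟨_, DirectedDiagram.isPrimitive_theta, DirectedDiagram.degree_theta, rfl⟩
  · have hle : DirectedDiagram.degreePart n ≤
        Submodule.span ℂ {DirectedDiagram.thetaPow DirectedDiagram.product n} := by
      refine Submodule.span_le.2 ?_
      rintro _ ⟨D, hD, rfl⟩
      rcases DirectedDiagram.cls_eq_zero_or_eq_thetaPow n D hD with h | h
      · rw [h]; exact Submodule.zero_mem _
      · rw [h]; exact Submodule.mem_span_singleton_self _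
    obtain ⟨c, hc⟩ := Submodule.mem_span_singleton.1 (hle hx)
    exact ⟨c, hc.symm⟩
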